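/- Let $d_1\le d_2\le\cdots$ be positive integers with $d_n\to\infty$, let $k\ge 1$ be an integer and let $\sigma>0$. For each $n$ let $X_n$ and $\Xi_n$ be independent random vectors in $\mathbb{R}^{d_n}$, where the distribution of $X_n$ is absolutely continuous with respect to Lebesgue measure, with characteristic function $\varphi_{X_n}$. Assume: (C.1) $\|X_n\|^2\to\sigma^2$ in probability as $n\to\infty$; (C.2) $X_n'\widetilde X_n\to 0$ in probability as $n\to\infty$, where $\widetilde X_n$ is an independent copy of $X_n$; (C.3) there is $n_0$ with $\mathbb{E}[(\det A_{n_0,k})^{-1/2}]<\infty$, where $A_{n,k}=(\widetilde X_{n,i}'\widetilde X_{n,r})_{i,r=1}^k$ is the Gram matrix of mutually independent copies $\widetilde X_{n,1},\dots,\widetilde X_{n,k}$ of $X_n$, and $0^{-1/2}=\infty$; (C.4) for every $n$ and almost every $\theta$ in the unit sphere $\mathcal{S}^{d_n-1}$ (with respect to surface measure), $\int_{-\infty}^\infty|\varphi_{X_n}(t\theta)|\,\mathrm{d}t<\infty$; (C.5) there is a function $\psi:[0,\infty)\to\mathbb{R}$, not depending on $n$, such that $\mathbb{E}\exp(\mathrm{i}u'\Xi_n)=\psi(\|u\|^2)$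 for all $n$ and all $u\in\mathbb{R}^{d_n}$. Then there is a probability distribution $G$ on $[0,\infty)$ such that $\psi(t)=\int_0^\infty\exp(-tv^2/2)\,\mathrm{d}G(v)$ for all $t\ge0$ (Schoenberg's theorem). Moreover, for any such $G$, let $V$ be a random variable with distribution $G$. If $\int_0^\infty v^{-k}\,\mathrm{d}G(v)<\infty$ (with $0^{-k}=\infty$), then, with $Y_n=\Xi_n'X_n$, for all $j=1,\dots,k$, $$\lim_{n\to\infty}\ \sup_{y\in\mathbb{R}}\Big|\mathbb{E}_{\Xi_n}\big[F_{Y_n|\Xi_n}(y)\big]^j-\mathbb{E}_V\big[F_{\mathcal{N}_1(0,\sigma^2V^2)}(y)\big]^j\Big|=0,$$ where $F_{Y_n|\Xi_n}$ is the conditional distribution function of $Y_n$ given $\Xi_n$, and $F_{\mathcal{N}_1(0,s)}$ is the distribution function of the normal distribution with mean $0$ and variance $s$. -/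

import Mathlib

open MeasureTheory ProbabilityTheory Filter Topology
open scoped ENNReal

noncomputable section

/-- `G` is a probability distribution on `[0, ∞)` representing `ψ` as the Gaussian scale mixture
`ψ t = ∫ exp (-t v² / 2) dG(v)` for all `t ≥ 0`. -/
structure IsGaussianMixing (ψ : ℝ → ℝ) (G : Measure ℝ) : Prop where
  isProbabilityMeasure : IsProbabilityMeasure G
  nonneg : ∀ᵐ v ∂G, 0 ≤ v
  mixture : ∀ t : ℝ, 0 ≤ t → ψ t = ∫ v, Real.exp (-(t * v ^ 2) / 2) ∂G

/-- `E[(det A)^(-1/2)]` where `A` is the Gram matrix of `k` independent copies of the random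
vector `X`, as an extended nonnegative number; the integrand is `∞` where `det A = 0`.
The copies are realised on the `k`-fold product space. -/
def expInvSqrtDetGram {Ω : Type*} [MeasurableSpace Ω] (μ : Measure Ω) {m : ℕ}
    (X : Ω → EuclideanSpace ℝ (Fin m)) (k : ℕ) : ℝ≥0∞ :=
  ∫⁻ ω : Fin k → Ω, ENNReal.ofReal (Matrix.gram ℝ fun i => X (ω i)).det ^ (-(1 / 2) : ℝ)
    ∂(Measure.pi fun _ => μ)

/-- The conditional distribution function `F_{Y|Ξ}(y)` at the value `ξ` of `Ξ`. -/
def condDistFun {Ω E : Type*} [MeasurableSpace Ω] [MeasurableSpace E] (μ : Measure Ω)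
    [IsFiniteMeasure μ] (Y : Ω → ℝ) (Ξ : Ω → E) (ξ : E) (y : ℝ) : ℝ :=
  cdf (condDistrib Y Ξ μ ξ) y

/-- The distribution function of the normal distribution `N(0, s)` with variance `s ≥ 0`. -/
def normalDistFun (s : ℝ) (y : ℝ) : ℝ :=
  cdf (gaussianReal 0 s.toNNReal) y

end

/-! Given `Ξ`, take independent copies of `X` sharing that `Ξ`. The j-th moment of the conditional
distribution function at `y` is the probability that all j products `⟨Ξ, X⁽ⁱ⁾⟩` are at most `y`
(`integral_condDistFun_pow`), so weak convergence of this j-dimensional law is what matters. Its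
characteristic function at `u` is `E ψ(‖∑ uᵢ X⁽ⁱ⁾‖²)`. By (C.1) and (C.2) the squared norm
concentrates at `σ²‖u‖²` (`tendstoInMeasure_norm_sum_sq`), so the limit is `ψ(σ²‖u‖²)`, the
characteristic function of `σV(Z₁, …, Zⱼ)` with `Zᵢ` independent standard normals. Lévy's continuity
theorem gives weak convergence. The negative moment of `G` excludes `V = 0`, so orthant boundaries
are null and the limit is continuous in `y`; Pólya's theorem makes the convergence uniform.

For Schoenberg's theorem, Parseval against a standard Gaussian `Z` gives `E exp(-t‖Ξₙ‖²/(2dₙ)) = E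
ψ(t‖Z‖²/dₙ)`, which tends to `ψ(t)` by the law of large numbers. Thus `W = exp(-‖Ξₙ‖²/(2dₙ))` has
moments `E Wᵗ` converging to `ψ(t)`. Compactness of the probability measures on `[0, 1]` yields a
limit `W`, and `V = √(-2 log W)`. -/

/-! ### Pólya's theorem on uniform convergence -/

/-- **Pólya's theorem**, local form: pointwise convergence of monotone functions to a continuous
function is locally uniform. -/
theorem tendstoLocallyUniformly_of_monotone {F : ℕ → ℝ → ℝ} {G : ℝ → ℝ}
    (hF : ∀ n, Monotone (F n)) (hG : Continuous G)
    (h : ∀ y, Tendsto (fun n => F n y) atTop (𝓝 (G y))) :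
    TendstoLocallyUniformly F G atTop := by
  rw [Metric.tendstoLocallyUniformly_iff]
  intro ε hε x
  obtain ⟨δ, hδ, hGδ⟩ := Metric.continuousAt_iff.1 (hG.continuousAt (x := x)) (ε / 4) (by positivity)
  have hG' : ∀ z, |z - x| < δ → |G z - G x| < ε / 4 := fun z hz => hGδ hz
  refine ⟨Metric.ball x (δ / 2), Metric.ball_mem_nhds _ (by positivity), ?_⟩
  have h1 := Metric.tendsto_nhds.1 (h (x + δ / 2)) (ε / 4) (by positivity)
  have h2 := Metric.tendsto_nhds.1 (h (x - δ / 2)) (ε / 4) (by positivity)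
  filter_upwards [h1, h2] with n h1 h2 y hy
  rw [Real.dist_eq, abs_lt] at h1 h2 ⊢
  rw [Metric.mem_ball, Real.dist_eq, abs_lt] at hy
  have a1 := abs_lt.1 (hG' (x + δ / 2) (by rw [abs_lt]; constructor <;> linarith))
  have a2 := abs_lt.1 (hG' (x - δ / 2) (by rw [abs_lt]; constructor <;> linarith))
  have a3 := abs_lt.1 (hG' y (by rw [abs_lt]; constructor <;> linarith))
  have b1 := hF n (show y ≤ x + δ / 2 by linarith)
  have b2 := hF n (show x - δ / 2 ≤ y by linarith)
  constructor <;> linarith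

/-- **Pólya's theorem**: pointwise convergence of distribution functions to a continuous
distribution function is uniform. -/
theorem tendsto_iSup_abs_sub_of_monotone {F : ℕ → ℝ → ℝ} {G : ℝ → ℝ}
    (hF : ∀ n, Monotone (F n)) (hF0 : ∀ n y, 0 ≤ F n y) (hF1 : ∀ n y, F n y ≤ 1)
    (hG : Monotone G) (hGc : Continuous G) (hG0 : Tendsto G atBot (𝓝 0))
    (hG1 : Tendsto G atTop (𝓝 1)) (h : ∀ y, Tendsto (fun n => F n y) atTop (𝓝 (G y))) :
    Tendsto (fun n => ⨆ y, |F n y - G y|) atTop (𝓝 0) := by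
  have hGnn : ∀ y, 0 ≤ G y := fun y => hG.le_of_tendsto hG0 y
  have hGle : ∀ y, G y ≤ 1 := fun y => hG.ge_of_tendsto hG1 y
  rw [Metric.tendsto_nhds]
  intro ε hε
  obtain ⟨a, ha⟩ := (hG0.eventually_lt_const (show (0 : ℝ) < ε / 4 by positivity)).exists
  obtain ⟨b, hb⟩ := (hG1.eventually_const_lt (show 1 - ε / 4 < (1 : ℝ) by linarith)).exists
  -- Outside `[a, b]`, monotonicity and convergence at the two endpoints suffice, since `G` is
  -- within `ε / 4` of its limits there.
  have hu := Metric.tendstoUniformlyOn_iff.1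
    ((tendstoLocallyUniformlyOn_iff_tendstoUniformlyOn_of_compact (isCompact_Icc (a := a) (b := b))).1
      (tendstoLocallyUniformly_of_monotone hF hGc h).tendstoLocallyUniformlyOn)
    (ε / 2) (by positivity)
  have h1 := Metric.tendsto_nhds.1 (h a) (ε / 4) (by positivity)
  have h2 := Metric.tendsto_nhds.1 (h b) (ε / 4) (by positivity)
  filter_upwards [hu, h1, h2] with n hu h1 h2
  rw [Real.dist_eq, abs_lt] at h1 h2
  have key : ∀ y, |F n y - G y| ≤ ε / 2 := by
    intro y
    rcases lt_or_ge y a with hya | hya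
    · have := hF n hya.le
      have := hG hya.le
      rw [abs_le]; constructor <;> linarith [hGnn y, hF0 n y]
    rcases lt_or_ge b y with hyb | hyb
    · have := hF n hyb.le
      have := hG hyb.le
      rw [abs_le]; constructor <;> linarith [hGle y, hF1 n y]
    have := hu y ⟨hya, hyb⟩
    rw [dist_comm, Real.dist_eq] at this
    exact this.le
  rw [Real.dist_eq, sub_zero, abs_of_nonneg (Real.iSup_nonneg fun _ => abs_nonneg _)]
  exact (ciSup_le key).trans_lt (by linarith)

/-! ### Convergence in probability to constants -/

section TendstoInMeasureConst

variable {Ω : Type*} [MeasurableSpace Ω] {μ : Measure Ω}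

theorem tendstoInMeasure_add_const {f g : ℕ → Ω → ℝ} {a b : ℝ}
    (hf : TendstoInMeasure μ f atTop fun _ => a) (hg : TendstoInMeasure μ g atTop fun _ => b) :
    TendstoInMeasure μ (fun n ω => f n ω + g n ω) atTop fun _ => a + b := by
  rw [tendstoInMeasure_iff_norm] at *
  intro ε hε
  have h := (hf (ε / 2) (by positivity)).add (hg (ε / 2) (by positivity))
  rw [add_zero] at h
  refine tendsto_of_tendsto_of_tendsto_of_le_of_le tendsto_const_nhds h (fun _ => zero_le) fun n => ?_
  refine (measure_mono fun ω hω => ?_).trans (measure_union_le _ _)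
  simp only [Set.mem_ofPred_eq, Set.mem_union, Real.norm_eq_abs] at hω ⊢
  by_contra! hcon
  have := abs_add_le (f n ω - a) (g n ω - b)
  rw [show f n ω - a + (g n ω - b) = f n ω + g n ω - (a + b) by ring] at this
  linarith

theorem tendstoInMeasure_const_mul {f : ℕ → Ω → ℝ} {a : ℝ} (c : ℝ)
    (hf : TendstoInMeasure μ f atTop fun _ => a) :
    TendstoInMeasure μ (fun n ω => c * f n ω) atTop fun _ => c * a := by
  rw [tendstoInMeasure_iff_norm] at *
  intro ε hε
  -- The threshold uses `|c| + 1` so that `c = 0` needs no separate case.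
  refine tendsto_of_tendsto_of_tendsto_of_le_of_le tendsto_const_nhds
    (hf (ε / (|c| + 1)) (by positivity)) (fun _ => zero_le) fun n => ?_
  refine measure_mono fun ω hω => ?_
  simp only [Set.mem_ofPred_eq, Real.norm_eq_abs] at hω ⊢
  rw [← mul_sub, abs_mul] at hω
  rw [div_le_iff₀ (by positivity)]
  nlinarith [abs_nonneg (f n ω - a)]

theorem tendstoInMeasure_sum_const {ι : Type*} (s : Finset ι) {f : ι → ℕ → Ω → ℝ} {a : ι → ℝ}
    (hf : ∀ i ∈ s, TendstoInMeasure μ (f i) atTop fun _ => a i) :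
    TendstoInMeasure μ (fun n ω => ∑ i ∈ s, f i n ω) atTop fun _ => ∑ i ∈ s, a i := by
  classical
  induction s using Finset.induction_on with
  | empty =>
    rw [tendstoInMeasure_iff_norm]
    intro ε hε
    simp [hε.not_ge]
  | insert i s hi ih =>
    simp only [Finset.sum_insert hi]
    exact tendstoInMeasure_add_const (hf i (by simp)) (ih fun k hk => hf k (by simp [hk]))

/-- Convergence in probability to a constant, precomposed with measure preserving maps. -/
theorem tendstoInMeasure_comp_measurePreserving {Ω' : Type*} [MeasurableSpace Ω'] {ν : Measure Ω'}
    {e : Ω' → Ω} (he : MeasurePreserving e ν μ) {f : ℕ → Ω → ℝ} (hfm : ∀ n, Measurable (f n)) {a : ℝ}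
    (hf : TendstoInMeasure μ f atTop fun _ => a) :
    TendstoInMeasure ν (fun n ω => f n (e ω)) atTop fun _ => a := by
  rw [tendstoInMeasure_iff_norm] at *
  intro ε hε
  refine (hf ε hε).congr fun n => ?_
  exact (he.measure_preimage (measurableSet_le measurable_const
    (((hfm n).sub_const a).norm)).nullMeasurableSet).symm

theorem tendsto_integral_comp_of_tendstoInMeasure [IsProbabilityMeasure μ] {f : ℕ → Ω → ℝ} {a : ℝ}
    (hfm : ∀ n, Measurable (f n)) (hf : TendstoInMeasure μ f atTop fun _ => a)
    {h : ℝ → ℝ} (hc : Continuous h) (hb : ∀ x, |h x| ≤ 1) :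
    Tendsto (fun n => ∫ ω, h (f n ω) ∂μ) atTop (𝓝 (h a)) := by
  have ht := (hf.tendstoInDistribution fun n => (hfm n).aemeasurable).tendsto
  have := ProbabilityMeasure.tendsto_iff_forall_integral_tendsto.1 ht (BoundedContinuousFunction.ofNormedAddCommGroup h hc 1 hb)
  simp only [ProbabilityMeasure.coe_mk, BoundedContinuousFunction.coe_ofNormedAddCommGroup] at this
  rw [integral_map (by fun_prop) hc.aestronglyMeasurable] at this
  simp only [integral_const, probReal_univ, one_smul] at this
  refine this.congr fun n => ?_
  rw [integral_map (hfm n).aemeasurable hc.aestronglyMeasurable]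

end TendstoInMeasureConst

/-! ### Schoenberg's theorem -/

/-- If `ψ (‖u‖ ^ 2)` is a characteristic function, then `ψ` is continuous and bounded by `1`
on `[0, ∞)`. -/
theorem continuous_and_abs_le_one_of_charFun_eq {E : Type*} [NormedAddCommGroup E]
    [InnerProductSpace ℝ E] [FiniteDimensional ℝ E] [Nontrivial E] [MeasurableSpace E]
    [BorelSpace E] {ρ : Measure E} [IsProbabilityMeasure ρ] {ψ : ℝ → ℝ}
    (h : ∀ u : E, charFun ρ u = ((ψ (‖u‖ ^ 2) : ℝ) : ℂ)) :
    Continuous (fun t => ψ (max t 0)) ∧ (∀ t, |ψ (max t 0)| ≤ 1) ∧ ψ 0 = 1 := by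
  obtain ⟨e, he⟩ := exists_norm_eq E (zero_le_one : (0 : ℝ) ≤ 1)
  -- Only values of `ψ` on `[0, ∞)` are determined; they are read off along a ray, and `max t 0`
  -- extends them continuously to the line.
  have key : ∀ t, ((ψ (max t 0) : ℝ) : ℂ) = charFun ρ (√(max t 0) • e) := by
    intro t
    rw [h, norm_smul, he, mul_one, Real.norm_eq_abs, sq_abs, Real.sq_sqrt (le_max_right _ _)]
  refine ⟨?_, fun t => ?_, ?_⟩
  · have : (fun t => ψ (max t 0)) = fun t => (charFun ρ (√(max t 0) • e)).re := by
      funext t; rw [← key, Complex.ofReal_re]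
    rw [this]
    have : Continuous (charFun ρ) := by fun_prop
    fun_prop
  · have := norm_charFun_le_one (μ := ρ) (√(max t 0) • e)
    rwa [← key, Complex.norm_real] at this
  · have := h 0
    simp only [charFun_zero, probReal_univ, norm_zero] at this
    norm_num at this
    exact_mod_cast this.symm

/-- Parseval's relation for characteristic functions. -/
theorem integral_charFun_smul_comm {E : Type*} [NormedAddCommGroup E] [InnerProductSpace ℝ E]
    [SecondCountableTopology E] [MeasurableSpace E] [BorelSpace E] (ρ ν : Measure E)
    [IsProbabilityMeasure ρ] [IsProbabilityMeasure ν] (s : ℝ) :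
    ∫ x, charFun ν (s • x) ∂ρ = ∫ z, charFun ρ (s • z) ∂ν := by
  simp only [charFun_apply, inner_smul_right]
  rw [integral_integral_swap]
  · simp only [real_inner_comm]
  · refine Integrable.of_bound (C := 1) ?_ (ae_of_all _ fun p => ?_)
    · apply Measurable.aestronglyMeasurable
      fun_prop
    · exact (Complex.norm_exp_ofReal_mul_I _).le

/-- Parseval's relation at scale `√t`, using that the standard Gaussian has characteristic function
`exp(-‖x‖²/2)`. -/
theorem integral_exp_neg_norm_sq_eq {m : ℕ} (ρ : Measure (EuclideanSpace ℝ (Fin m)))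
    [IsProbabilityMeasure ρ] {ψ : ℝ → ℝ}
    (h : ∀ u : EuclideanSpace ℝ (Fin m), charFun ρ u = ((ψ (‖u‖ ^ 2) : ℝ) : ℂ)) {t : ℝ}
    (ht : 0 ≤ t) :
    ∫ x, Real.exp (-(t * ‖x‖ ^ 2) / 2) ∂ρ
      = ∫ z, ψ (t * ‖z‖ ^ 2) ∂(stdGaussian (EuclideanSpace ℝ (Fin m))) := by
  have key := integral_charFun_smul_comm ρ (stdGaussian (EuclideanSpace ℝ (Fin m))) √t
  have hn : ∀ x : EuclideanSpace ℝ (Fin m), ‖√t • x‖ ^ 2 = t * ‖x‖ ^ 2 := fun x => by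
    rw [norm_smul, mul_pow, Real.norm_eq_abs, sq_abs, Real.sq_sqrt ht]
  have h1 : ∀ x : EuclideanSpace ℝ (Fin m),
      charFun (stdGaussian (EuclideanSpace ℝ (Fin m))) (√t • x)
        = ((Real.exp (-(t * ‖x‖ ^ 2) / 2) : ℝ) : ℂ) := fun x => by
    rw [charFun_stdGaussian, ← Complex.ofReal_pow, hn]
    push_cast
    rfl
  simp only [h1, h, hn, integral_complex_ofReal] at key
  exact_mod_cast key

/-- Couples the Gaussians of all dimensions on one sequence space, so that the strong law applies to
their norms. -/
theorem stdGaussian_eq_map_infinitePi (m : ℕ) :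
    stdGaussian (EuclideanSpace ℝ (Fin m))
      = (Measure.infinitePi fun _ : ℕ => gaussianReal 0 1).map
        (fun z : ℕ → ℝ => WithLp.toLp 2 fun i : Fin m => z i) := by
  rw [← map_pi_eq_stdGaussian, ← Measure.infinitePi_eq_pi,
    ← Measure.map_infinitePi_infinitePi_of_inj (P := fun _ : ℕ => gaussianReal 0 1)
      (f := fun i : Fin m => (i : ℕ)) Fin.val_injective, Measure.map_map (by fun_prop) (by fun_prop)]
  rfl

theorem ae_tendsto_sum_sq_div :
    ∀ᵐ z : ℕ → ℝ ∂(Measure.infinitePi fun _ : ℕ => gaussianReal 0 1),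
      Tendsto (fun n : ℕ => (∑ i ∈ Finset.range n, z i ^ 2) / n) atTop (𝓝 1) := by
  have hind := iIndepFun_infinitePi (P := fun _ : ℕ => gaussianReal 0 1)
    (X := fun _ x => x ^ 2) (by fun_prop)
  have hmp := fun i => measurePreserving_eval_infinitePi (fun _ : ℕ => gaussianReal 0 1) i
  have hint : Integrable (fun x : ℝ => x ^ 2) (gaussianReal 0 1) :=
    (memLp_id_gaussianReal 2).integrable_sq
  have hsl := strong_law_ae_real (μ := Measure.infinitePi fun _ : ℕ => gaussianReal 0 1)
    (fun i (z : ℕ → ℝ) => z i ^ 2) ((hmp 0).integrable_comp_of_integrable hint)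
    (fun i k hik => hind.indepFun hik) (fun i => by
      refine ⟨Measurable.aemeasurable (by fun_prop), Measurable.aemeasurable (by fun_prop), ?_⟩
      have h1 := Measure.map_map (μ := Measure.infinitePi fun _ : ℕ => gaussianReal 0 1)
        (f := fun z : ℕ → ℝ => z i) (g := fun x : ℝ => x ^ 2) (by fun_prop) (by fun_prop)
      have h2 := Measure.map_map (μ := Measure.infinitePi fun _ : ℕ => gaussianReal 0 1)
        (f := fun z : ℕ → ℝ => z 0) (g := fun x : ℝ => x ^ 2) (by fun_prop) (by fun_prop)
      have e1 := (hmp i).map_eq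
      have e2 := (hmp 0).map_eq
      change Measure.map (fun z : ℕ → ℝ => z i) _ = _ at e1
      change Measure.map (fun z : ℕ → ℝ => z 0) _ = _ at e2
      rw [e1] at h1
      rw [e2] at h2
      exact h1.symm.trans h2)
  have hval : ∫ z : ℕ → ℝ, z 0 ^ 2 ∂(Measure.infinitePi fun _ : ℕ => gaussianReal 0 1) = 1 := by
    have h1 := integral_map (μ := Measure.infinitePi fun _ : ℕ => gaussianReal 0 1)
      (φ := fun z : ℕ → ℝ => z 0) (f := fun x : ℝ => x ^ 2) (Measurable.aemeasurable (by fun_prop))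
      (Measurable.aestronglyMeasurable (by fun_prop))
    have e2 := (hmp 0).map_eq
    change Measure.map (fun z : ℕ → ℝ => z 0) _ = _ at e2
    rw [← h1, e2]
    have := variance_id_gaussianReal (μ := 0) (v := 1)
    rw [variance_of_integral_eq_zero (by fun_prop) (by simp)] at this
    simpa using this
  rw [hval] at hsl
  exact hsl

/-- A rotationally invariant function of high-dimensional Gaussian vectors concentrates. -/
theorem tendsto_integral_stdGaussian_norm_sq {d : ℕ → ℕ} (hd : Tendsto d atTop atTop) {f : ℝ → ℝ}
    (hf : Continuous f) (hb : ∀ x, |f x| ≤ 1) (t : ℝ) :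
    Tendsto (fun n => ∫ z, f (t / d n * ‖z‖ ^ 2) ∂(stdGaussian (EuclideanSpace ℝ (Fin (d n)))))
      atTop (𝓝 (f t)) := by
  have h1 : ∀ n, ∫ z, f (t / d n * ‖z‖ ^ 2) ∂(stdGaussian (EuclideanSpace ℝ (Fin (d n))))
      = ∫ z : ℕ → ℝ, f (t * ((∑ i ∈ Finset.range (d n), z i ^ 2) / d n))
          ∂(Measure.infinitePi fun _ : ℕ => gaussianReal 0 1) := fun n => by
    rw [stdGaussian_eq_map_infinitePi, integral_map (Measurable.aemeasurable (by fun_prop))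
      (Continuous.aestronglyMeasurable (by fun_prop))]
    refine integral_congr_ae (ae_of_all _ fun z => ?_)
    simp only [EuclideanSpace.real_norm_sq_eq]
    rw [Fin.sum_univ_eq_sum_range (fun i => z i ^ 2)]
    congr 1
    ring
  simp only [h1]
  have h2 : f t = ∫ _, f t ∂(Measure.infinitePi fun _ : ℕ => gaussianReal 0 1) := by simp
  rw [h2]
  refine tendsto_integral_of_dominated_convergence (fun _ => 1) (fun n => ?_) (by simp)
    (fun n => ae_of_all _ fun z => hb _) ?_
  · exact (hf.measurable.comp (by fun_prop)).aestronglyMeasurable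
  · filter_upwards [ae_tendsto_sum_sq_div] with z hz
    refine (hf.tendsto t).comp ?_
    simpa using (hz.comp hd).const_mul t

/-- Cluster points of moment sequences on the unit interval: a limit of the functions
`t ↦ E[W ^ t]` for `W` with values in `[0, 1]` is again of this form. -/
theorem exists_measure_unitInterval_of_tendsto_rpow (L : ℕ → ProbabilityMeasure unitInterval)
    {ψ : ℝ → ℝ} (h : ∀ t, 0 < t → Tendsto (fun n => ∫ w : unitInterval, (w : ℝ) ^ t ∂(L n : Measure unitInterval))
      atTop (𝓝 (ψ t))) :
    ∃ M : ProbabilityMeasure unitInterval, ∀ t, 0 < t →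
      ∫ w : unitInterval, (w : ℝ) ^ t ∂(M : Measure unitInterval) = ψ t := by
  -- A limit along an ultrafilter replaces the extraction of a subsequence.
  obtain ⟨M, -, hM⟩ := isCompact_univ.ultrafilter_le_nhds ((hyperfilter ℕ).map L) (by simp)
  refine ⟨M, fun t ht => ?_⟩
  have hM' : Tendsto L (hyperfilter ℕ) (𝓝 M) := hM
  have hc : Continuous fun w : unitInterval => (w : ℝ) ^ t :=
    continuous_subtype_val.rpow_const fun _ => Or.inr ht.le
  have := ProbabilityMeasure.tendsto_iff_forall_integral_tendsto.1 hM'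
    (BoundedContinuousFunction.mkOfCompact ⟨_, hc⟩)
  simp only [BoundedContinuousFunction.mkOfCompact_apply, ContinuousMap.coe_mk] at this
  exact tendsto_nhds_unique this ((h t ht).mono_left Nat.hyperfilter_le_atTop)

theorem tendsto_rpow_zero_of_nonneg {x : ℝ} (hx : 0 ≤ x) :
    Tendsto (fun n : ℕ => x ^ (1 / ((n : ℝ) + 1))) atTop (𝓝 (if x = 0 then 0 else 1)) := by
  split_ifs with h
  · subst h
    refine tendsto_const_nhds.congr fun n => ?_
    rw [Real.zero_rpow (by positivity)]
  · have := (Real.continuousAt_const_rpow h (b := 0)).tendsto.comp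
      tendsto_one_div_add_atTop_nhds_zero_nat
    simpa [Function.comp_def] using this

/-- A distribution on `[0, 1]` whose moments `E[W ^ t]` tend to `1` as `t → 0` has no atom at `0`. -/
theorem ae_pos_of_integral_rpow {M : Measure unitInterval} [IsProbabilityMeasure M] {ψ : ℝ → ℝ}
    (h : ∀ t, 0 < t → ∫ w : unitInterval, (w : ℝ) ^ t ∂M = ψ t)
    (hψ : Tendsto (fun n : ℕ => ψ (1 / ((n : ℝ) + 1))) atTop (𝓝 1)) :
    ∀ᵐ w : unitInterval ∂M, 0 < (w : ℝ) := by
  -- As the exponent decreases to `0`, `w ^ t` tends to the indicator of `w ≠ 0`, so the limit of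
  -- the moments is the mass off `0`.
  have h1 : Tendsto (fun n : ℕ => ∫ w : unitInterval, (w : ℝ) ^ (1 / ((n : ℝ) + 1)) ∂M) atTop
      (𝓝 (∫ w : unitInterval, (if (w : ℝ) = 0 then (0 : ℝ) else 1) ∂M)) := by
    refine tendsto_integral_of_dominated_convergence (fun _ => 1)
      (fun n => Measurable.aestronglyMeasurable (by fun_prop)) (by simp)
      (fun n => ae_of_all _ fun w => ?_)
      (ae_of_all _ fun w => tendsto_rpow_zero_of_nonneg w.2.1)
    rw [Real.norm_of_nonneg (Real.rpow_nonneg w.2.1 _)]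
    exact Real.rpow_le_one w.2.1 w.2.2 (by positivity)
  have h2 : ∫ w : unitInterval, (if (w : ℝ) = 0 then (0 : ℝ) else 1) ∂M = 1 := by
    refine tendsto_nhds_unique h1 (hψ.congr fun n => ?_)
    rw [h _ (by positivity)]
  have hms : MeasurableSet {w : unitInterval | (w : ℝ) = 0} :=
    measurableSet_eq_fun measurable_subtype_coe measurable_const
  have hi : Integrable (fun w : unitInterval => if (w : ℝ) = 0 then (0 : ℝ) else 1) M := by
    refine Integrable.of_bound (C := 1) ?_ (ae_of_all _ fun w => ?_)
    · exact (Measurable.ite hms measurable_const measurable_const).aestronglyMeasurable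
    · split_ifs <;> simp
  have hi' : Integrable (fun w : unitInterval => 1 - if (w : ℝ) = 0 then (0 : ℝ) else 1) M :=
    (integrable_const 1).sub hi
  have h3 : ∫ w : unitInterval, (1 - if (w : ℝ) = 0 then (0 : ℝ) else 1) ∂M = 0 := by
    rw [integral_sub (f := fun _ => 1) (integrable_const _) hi, h2]
    simp
  rw [integral_eq_zero_iff_of_nonneg (fun w => by dsimp only; split_ifs <;> simp) hi'] at h3
  filter_upwards [h3] with w hw
  refine lt_of_le_of_ne w.2.1 fun h0 => ?_
  simp [← h0] at hw

/-- **Schoenberg's theorem**: a function that is radially positive definite in arbitrarily large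
dimensions is a mixture of Gaussian characteristic functions. -/
theorem exists_isGaussianMixing {d : ℕ → ℕ} (hd_pos : ∀ n, 0 < d n) (hd : Tendsto d atTop atTop)
    (ρ : ∀ n, Measure (EuclideanSpace ℝ (Fin (d n)))) [∀ n, IsProbabilityMeasure (ρ n)] {ψ : ℝ → ℝ}
    (h : ∀ n, ∀ u : EuclideanSpace ℝ (Fin (d n)), charFun (ρ n) u = ((ψ (‖u‖ ^ 2) : ℝ) : ℂ)) :
    ∃ G : Measure ℝ, IsGaussianMixing ψ G := by
  have : ∀ n, Nonempty (Fin (d n)) := fun n => ⟨⟨0, hd_pos n⟩⟩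
  obtain ⟨hc, hb, h0⟩ := continuous_and_abs_le_one_of_charFun_eq (h 0)
  let w : ∀ n, EuclideanSpace ℝ (Fin (d n)) → unitInterval := fun n x =>
    ⟨Real.exp (-(1 / d n * ‖x‖ ^ 2) / 2), (Real.exp_pos _).le, Real.exp_le_one_iff.2 (by
      have : 0 ≤ 1 / (d n : ℝ) * ‖x‖ ^ 2 := by positivity
      linarith)⟩
  have hw : ∀ n, Measurable (w n) := fun n => Measurable.subtype_mk (by fun_prop)
  obtain ⟨M, hM⟩ := exists_measure_unitInterval_of_tendsto_rpow (ψ := ψ)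
    (fun n => ⟨(ρ n).map (w n), Measure.isProbabilityMeasure_map (hw n).aemeasurable⟩)
    (fun t ht => by
      have h1 := tendsto_integral_stdGaussian_norm_sq hd hc hb t
      rw [max_eq_left ht.le] at h1
      refine h1.congr fun n => ?_
      have hnn : ∀ z : EuclideanSpace ℝ (Fin (d n)), 0 ≤ t / d n * ‖z‖ ^ 2 := fun z => by positivity
      simp only [max_eq_left (hnn _)]
      rw [← integral_exp_neg_norm_sq_eq (ρ n) (h n) (by positivity), ProbabilityMeasure.coe_mk,
        integral_map (hw n).aemeasurable (Measurable.aestronglyMeasurable (by fun_prop))]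
      refine integral_congr_ae (ae_of_all _ fun x => ?_)
      simp only [w]
      rw [← Real.exp_mul]
      congr 1
      ring)
  have hpos := ae_pos_of_integral_rpow (M := (M : Measure unitInterval)) hM (by
    have := (hc.tendsto 0).comp tendsto_one_div_add_atTop_nhds_zero_nat
    simp only [max_self, h0] at this
    refine this.congr fun n => ?_
    rw [Function.comp_apply, max_eq_left (by positivity)])
  -- Inverts `w = exp(-v²/2)`. The value at `w = 0` is irrelevant, because `M` has no atom there.
  let v : unitInterval → ℝ := fun w => √(-2 * Real.log w)
  have hv : Measurable v := by fun_prop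
  refine ⟨(M : Measure unitInterval).map v, Measure.isProbabilityMeasure_map hv.aemeasurable, ?_, ?_⟩
  · rw [ae_map_iff hv.aemeasurable measurableSet_Ici]
    exact ae_of_all _ fun w => Real.sqrt_nonneg _
  · intro t ht
    rw [integral_map hv.aemeasurable (Measurable.aestronglyMeasurable (by fun_prop))]
    rcases ht.eq_or_lt with rfl | ht
    · simp [h0]
    rw [← hM t ht]
    refine integral_congr_ae ?_
    filter_upwards [hpos] with x hx
    have : 0 ≤ -2 * Real.log x := by
      have := Real.log_nonpos x.2.1 x.2.2
      linarith
    simp only [v]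
    rw [Real.sq_sqrt this, Real.rpow_def_of_pos hx]
    congr 1
    ring

/-! ### Conditionally independent coordinates with a shared factor -/

/-- The law of `(f a (b i))_i`, where `a ∼ ρ` and the `b i ∼ ν` are all independent. -/
noncomputable def mixedProductLaw {A B : Type*} [MeasurableSpace A] [MeasurableSpace B]
    (ρ : Measure A) (ν : Measure B) (f : A → B → ℝ) (j : ℕ) : Measure (EuclideanSpace ℝ (Fin j)) :=
  (ρ.prod (Measure.pi fun _ : Fin j => ν)).map fun p => WithLp.toLp 2 fun i => f p.1 (p.2 i)

section MixedProductLaw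

variable {A B : Type*} [MeasurableSpace A] [MeasurableSpace B] {ρ : Measure A} {ν : Measure B}
  [IsProbabilityMeasure ρ] [IsProbabilityMeasure ν] {f : A → B → ℝ} {j : ℕ}

theorem measurable_toLp_mixed (hf : Measurable (Function.uncurry f)) :
    Measurable fun p : A × (Fin j → B) =>
      (WithLp.toLp 2 fun i => f p.1 (p.2 i) : EuclideanSpace ℝ (Fin j)) := by
  refine (WithLp.measurable_toLp 2 (Fin j → ℝ)).comp (measurable_pi_lambda _ fun i => ?_)
  exact hf.comp (measurable_fst.prodMk ((measurable_pi_apply i).comp measurable_snd))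

theorem isProbabilityMeasure_mixedProductLaw (hf : Measurable (Function.uncurry f)) :
    IsProbabilityMeasure (mixedProductLaw ρ ν f j) :=
  Measure.isProbabilityMeasure_map (measurable_toLp_mixed hf).aemeasurable

omit [IsProbabilityMeasure ρ] [IsProbabilityMeasure ν] in
theorem charFun_mixedProductLaw (hf : Measurable (Function.uncurry f))
    (u : EuclideanSpace ℝ (Fin j)) :
    charFun (mixedProductLaw ρ ν f j) u = ∫ p : A × (Fin j → B),
      Complex.exp (((∑ i, u i * f p.1 (p.2 i) : ℝ) : ℂ) * Complex.I)
        ∂(ρ.prod (Measure.pi fun _ : Fin j => ν)) := by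
  rw [charFun_apply, mixedProductLaw, integral_map (measurable_toLp_mixed hf).aemeasurable
    (Measurable.aestronglyMeasurable (by fun_prop))]
  refine integral_congr_ae (ae_of_all _ fun p => ?_)
  simp [PiLp.inner_apply]

theorem integrable_cexp_sum_mixed (hf : Measurable (Function.uncurry f))
    (u : EuclideanSpace ℝ (Fin j)) :
    Integrable (fun p : A × (Fin j → B) =>
      Complex.exp (((∑ i, u i * f p.1 (p.2 i) : ℝ) : ℂ) * Complex.I))
        (ρ.prod (Measure.pi fun _ : Fin j => ν)) := by
  refine Integrable.of_bound (C := 1) (Measurable.aestronglyMeasurable ?_)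
    (ae_of_all _ fun p => (Complex.norm_exp_ofReal_mul_I _).le)
  have : ∀ i, Measurable fun p : A × (Fin j → B) => f p.1 (p.2 i) := fun i =>
    hf.comp (measurable_fst.prodMk ((measurable_pi_apply i).comp measurable_snd))
  fun_prop

-- For fixed `a` the coordinates are i.i.d., so the orthant has conditional probability a j-th
-- power; Fubini then integrates over `a`.
omit [IsProbabilityMeasure ρ] in
theorem mixedProductLaw_real_orthant (hf : Measurable (Function.uncurry f)) (y : ℝ) :
    (mixedProductLaw ρ ν f j).real {x | ∀ i, x i ≤ y} = ∫ a, ν.real {b | f a b ≤ y} ^ j ∂ρ := by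
  have hms : MeasurableSet {x : EuclideanSpace ℝ (Fin j) | ∀ i, x i ≤ y} := by
    simp only [Set.ofPred_forall]
    exact MeasurableSet.iInter fun i => measurableSet_le (by fun_prop) measurable_const
  have hm := measurable_toLp_mixed (j := j) hf
  have hslice : ∀ a, MeasurableSet {b | f a b ≤ y} := fun a =>
    measurableSet_le (hf.comp (measurable_const.prodMk measurable_id)) measurable_const
  have hmν : Measurable fun a => ν {b | f a b ≤ y} :=
    measurable_measure_prodMk_left (measurableSet_le hf measurable_const)
  have hpi : ∀ a, (Measure.pi fun _ : Fin j => ν) {b | ∀ i, f a (b i) ≤ y}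
      = ν {b | f a b ≤ y} ^ j := fun a => by
    rw [show {b : Fin j → B | ∀ i, f a (b i) ≤ y} = Set.univ.pi fun _ => {b | f a b ≤ y} by
      ext; simp, Measure.pi_pi]
    simp
  rw [Measure.real, mixedProductLaw, Measure.map_apply hm hms, Measure.prod_apply (hm hms)]
  rw [show (∫ a, ν.real {b | f a b ≤ y} ^ j ∂ρ) = ∫ a, (ν {b | f a b ≤ y} ^ j).toReal ∂ρ by
    simp [Measure.real, ENNReal.toReal_pow]]
  rw [integral_toReal (hmν.pow_const j).aemeasurable
    (ae_of_all _ fun a => ENNReal.pow_lt_top (measure_lt_top _ _))]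
  congr 1
  exact lintegral_congr fun a => hpi a

end MixedProductLaw

/-! ### Orthants and normal distribution functions -/

theorem frontier_orthant_subset {j : ℕ} (y : ℝ) :
    frontier {x : EuclideanSpace ℝ (Fin j) | ∀ i, x i ≤ y} ⊆ ⋃ i, {x | x i = y} := by
  have hcl : IsClosed {x : EuclideanSpace ℝ (Fin j) | ∀ i, x i ≤ y} := by
    simp only [Set.ofPred_forall]
    exact isClosed_iInter fun i => isClosed_le (by fun_prop) continuous_const
  have hop : IsOpen {x : EuclideanSpace ℝ (Fin j) | ∀ i, x i < y} := by
    simp only [Set.ofPred_forall]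
    exact isOpen_iInter_of_finite fun i => isOpen_lt (by fun_prop) continuous_const
  intro x hx
  rw [hcl.frontier_eq] at hx
  by_contra hcon
  simp only [Set.mem_iUnion, Set.mem_ofPred_eq, not_exists] at hcon
  refine hx.2 (interior_maximal (fun z hz i => (hz i).le) hop (fun i => ?_))
  exact lt_of_le_of_ne (hx.1 i) (hcon i)

theorem continuous_cdf {μ : Measure ℝ} [IsProbabilityMeasure μ] [NullSingletonClass μ] :
    Continuous (cdf μ) := by
  rw [continuous_iff_continuousAt]
  intro x
  rw [(monotone_cdf μ).continuousAt_iff_leftLim_eq_rightLim, StieltjesFunction.rightLim_eq]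
  -- The jump of the distribution function at `x` is the mass of `{x}`.
  have h := (cdf μ).measure_singleton x
  rw [measure_cdf, measure_singleton, eq_comm, ENNReal.ofReal_eq_zero] at h
  exact le_antisymm ((monotone_cdf μ).leftLim_le le_rfl) (by linarith)

/-- Writing `N(0, c²)` as the law of `cZ` covers the degenerate case `c = 0` and makes measurability
in the scale visible. -/
theorem normalDistFun_eq (c y : ℝ) :
    normalDistFun (c ^ 2) y = (gaussianReal 0 1).real {z | c * z ≤ y} := by
  have h := gaussianReal_map_const_mul (μ := 0) (v := 1) c
  rw [normalDistFun, cdf_eq_real, show (c ^ 2).toNNReal = NNReal.mk (c ^ 2) (sq_nonneg c) * 1 by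
    rw [mul_one, Real.toNNReal_of_nonneg (sq_nonneg c)]]
  rw [mul_zero] at h
  rw [← h, map_measureReal_apply (by fun_prop) measurableSet_Iic]
  rfl

theorem continuous_normalDistFun {s : ℝ} (hs : 0 < s) : Continuous (normalDistFun s) := by
  have := nullSingletonClass_gaussianReal (μ := 0) (v := s.toNNReal) (by simpa using hs)
  exact continuous_cdf

theorem normalDistFun_nonneg (s y : ℝ) : 0 ≤ normalDistFun s y := cdf_nonneg _ _

theorem normalDistFun_le_one (s y : ℝ) : normalDistFun s y ≤ 1 := cdf_le_one _ _

theorem abs_normalDistFun_pow_le_one (s y : ℝ) (j : ℕ) : ‖normalDistFun s y ^ j‖ ≤ 1 := by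
  rw [Real.norm_of_nonneg (pow_nonneg (normalDistFun_nonneg _ _) _)]
  exact pow_le_one₀ (normalDistFun_nonneg _ _) (normalDistFun_le_one _ _)

theorem measurable_normalDistFun_sq (σ y : ℝ) :
    Measurable fun v => normalDistFun (σ ^ 2 * v ^ 2) y := by
  simp only [← mul_pow, normalDistFun_eq]
  have : Measurable fun v : ℝ => gaussianReal 0 1 {z | σ * v * z ≤ y} :=
    measurable_measure_prodMk_left (s := {p : ℝ × ℝ | σ * p.1 * p.2 ≤ y})
      (measurableSet_le (by fun_prop) measurable_const)
  exact this.ennreal_toReal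

/-! ### The limiting Gaussian mixture -/

section Mixture

variable {G : Measure ℝ} [IsProbabilityMeasure G] {σ : ℝ} {j : ℕ}

theorem integrable_normalDistFun_pow (y : ℝ) :
    Integrable (fun v => normalDistFun (σ ^ 2 * v ^ 2) y ^ j) G :=
  Integrable.of_bound ((measurable_normalDistFun_sq σ y).pow_const j).aestronglyMeasurable 1
    (ae_of_all _ fun _ => abs_normalDistFun_pow_le_one _ _ _)

theorem monotone_integral_normalDistFun_pow :
    Monotone fun y => ∫ v, normalDistFun (σ ^ 2 * v ^ 2) y ^ j ∂G := fun _ _ hy =>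
  integral_mono (integrable_normalDistFun_pow _) (integrable_normalDistFun_pow _) fun _ =>
    pow_le_pow_left₀ (normalDistFun_nonneg _ _) (monotone_cdf _ hy) _

theorem tendsto_integral_normalDistFun_pow {l : Filter ℝ} [l.IsCountablyGenerated] {g : ℝ → ℝ}
    (h : ∀ᵐ v ∂G, Tendsto (normalDistFun (σ ^ 2 * v ^ 2)) l (𝓝 (g v))) :
    Tendsto (fun y => ∫ v, normalDistFun (σ ^ 2 * v ^ 2) y ^ j ∂G) l (𝓝 (∫ v, g v ^ j ∂G)) := by
  refine tendsto_integral_filter_of_dominated_convergence (fun _ => 1)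
    (Eventually.of_forall fun y => (integrable_normalDistFun_pow y).aestronglyMeasurable)
    (Eventually.of_forall fun y => ae_of_all _ fun _ => abs_normalDistFun_pow_le_one _ _ _)
    (by simp) ?_
  filter_upwards [h] with v hv using hv.pow j

/-- Dominated convergence; for `v = 0` the integrand would jump at `y = 0`, hence the exclusion of
an atom of `G` there. -/
theorem continuous_integral_normalDistFun_pow (hσ : σ ≠ 0) (hG : ∀ᵐ v ∂G, v ≠ 0) :
    Continuous fun y => ∫ v, normalDistFun (σ ^ 2 * v ^ 2) y ^ j ∂G := by
  rw [continuous_iff_continuousAt]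
  intro y
  refine tendsto_integral_normalDistFun_pow ?_
  filter_upwards [hG] with v hv
  exact (continuous_normalDistFun (by positivity)).tendsto y

theorem tendsto_integral_normalDistFun_pow_atBot (hj : j ≠ 0) :
    Tendsto (fun y => ∫ v, normalDistFun (σ ^ 2 * v ^ 2) y ^ j ∂G) atBot (𝓝 0) := by
  have := tendsto_integral_normalDistFun_pow (G := G) (σ := σ) (j := j) (g := fun _ => 0)
    (ae_of_all _ fun v => tendsto_cdf_atBot _)
  simpa [hj] using this

theorem tendsto_integral_normalDistFun_pow_atTop :
    Tendsto (fun y => ∫ v, normalDistFun (σ ^ 2 * v ^ 2) y ^ j ∂G) atTop (𝓝 1) := by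
  have := tendsto_integral_normalDistFun_pow (G := G) (σ := σ) (j := j) (g := fun _ => 1)
    (ae_of_all _ fun v => tendsto_cdf_atTop _)
  simpa using this

omit [IsProbabilityMeasure G] in
theorem gaussianMixture_real_orthant (y : ℝ) :
    (mixedProductLaw G (gaussianReal 0 1) (fun v z => σ * v * z) j).real {x | ∀ i, x i ≤ y}
      = ∫ v, normalDistFun (σ ^ 2 * v ^ 2) y ^ j ∂G := by
  rw [mixedProductLaw_real_orthant (by simp only [Function.uncurry_def]; fun_prop)]
  simp only [← mul_pow, normalDistFun_eq]

omit [IsProbabilityMeasure G] in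
theorem gaussianMixture_coord_eq (hσ : σ ≠ 0) (hG : ∀ᵐ v ∂G, v ≠ 0) (i : Fin j) (y : ℝ) :
    mixedProductLaw G (gaussianReal 0 1) (fun v z => σ * v * z) j {x | x i = y} = 0 := by
  have hf : Measurable (Function.uncurry fun v z : ℝ => σ * v * z) := by
    simp only [Function.uncurry_def]; fun_prop
  have hms : MeasurableSet {x : EuclideanSpace ℝ (Fin j) | x i = y} :=
    measurableSet_eq_fun (by fun_prop) measurable_const
  have hm := measurable_toLp_mixed (j := j) hf
  rw [mixedProductLaw, Measure.map_apply hm hms, Measure.measure_prod_null (hm hms)]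
  filter_upwards [hG] with v hv
  -- For fixed `v ≠ 0` the condition pins `z i` to a single value, which is Gaussian-null.
  have hsub : (Prod.mk v ⁻¹' ((fun p : ℝ × (Fin j → ℝ) =>
      (WithLp.toLp 2 fun i => σ * p.1 * p.2 i : EuclideanSpace ℝ (Fin j))) ⁻¹' {x | x i = y}))
      ⊆ Function.eval i ⁻¹' {y / (σ * v)} := by
    intro z hz
    have hz : σ * v * z i = y := hz
    rw [Set.mem_preimage, Set.mem_singleton_iff, eq_div_iff (mul_ne_zero hσ hv), ← hz]
    exact mul_comm _ _
  refine measure_mono_null hsub ?_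
  have := nullSingletonClass_gaussianReal (μ := 0) (v := 1) one_ne_zero
  rw [(measurePreserving_eval (fun _ : Fin j => gaussianReal 0 1) i).measure_preimage
    (measurableSet_singleton _).nullMeasurableSet, measure_singleton]

theorem charFun_gaussianMixture {ψ : ℝ → ℝ} (h : IsGaussianMixing ψ G)
    (u : EuclideanSpace ℝ (Fin j)) :
    charFun (mixedProductLaw G (gaussianReal 0 1) (fun v z => σ * v * z) j) u
      = ((ψ (σ ^ 2 * ‖u‖ ^ 2) : ℝ) : ℂ) := by
  have hf : Measurable (Function.uncurry fun v z : ℝ => σ * v * z) := by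
    simp only [Function.uncurry_def]; fun_prop
  rw [charFun_mixedProductLaw hf, integral_prod _ (integrable_cexp_sum_mixed hf u),
    h.mixture _ (by positivity), ← integral_complex_ofReal]
  refine integral_congr_ae (ae_of_all _ fun v => ?_)
  have h1 := charFun_stdGaussian ((σ * v) • u)
  rw [← map_pi_eq_stdGaussian, charFun_apply, integral_map (by fun_prop)
    (Measurable.aestronglyMeasurable (by fun_prop))] at h1
  simp only [norm_smul, PiLp.inner_apply, PiLp.smul_apply, smul_eq_mul, RCLike.inner_apply,
    conj_trivial] at h1
  have h2 : (‖σ * v‖ * ‖u‖) ^ 2 = σ ^ 2 * ‖u‖ ^ 2 * v ^ 2 := by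
    rw [mul_pow, Real.norm_eq_abs, sq_abs]; ring
  rw [← Complex.ofReal_pow, h2] at h1
  push_cast at h1 ⊢
  rw [← h1]
  refine integral_congr_ae (ae_of_all _ fun z => ?_)
  dsimp only
  congr 2
  refine Finset.sum_congr rfl fun i _ => ?_
  ring

end Mixture

/-! ### Conditional laws given the spherical vector -/

section Conditional

variable {Ω : Type*} [MeasurableSpace Ω] {μ : Measure Ω} [IsProbabilityMeasure μ] {m : ℕ}
  {X Ξ : Ω → EuclideanSpace ℝ (Fin m)}

theorem measurable_uncurry_inner :
    Measurable (Function.uncurry fun ξ x : EuclideanSpace ℝ (Fin m) => (inner ℝ ξ x : ℝ)) := by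
  simp only [Function.uncurry_def]; fun_prop

/-- If `X` and `Ξ` are independent, the conditional law of `⟨Ξ, X⟩` given `Ξ = ξ` is the law
of `⟨ξ, X⟩`. -/
theorem condDistrib_inner_of_indepFun (hX : Measurable X) (hΞ : Measurable Ξ)
    (h : IndepFun X Ξ μ) :
    ∀ᵐ ξ ∂(μ.map Ξ), condDistrib (fun ω => (inner ℝ (Ξ ω) (X ω) : ℝ)) Ξ μ ξ
      = (μ.map X).map fun x => inner ℝ ξ x := by
  have : IsProbabilityMeasure (μ.map X) := Measure.isProbabilityMeasure_map hX.aemeasurable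
  have : IsProbabilityMeasure (μ.map Ξ) := Measure.isProbabilityMeasure_map hΞ.aemeasurable
  have hin := measurable_uncurry_inner (m := m)
  -- The candidate kernel: freeze `ξ`, draw `x` from the law of `X`, and take the inner product.
  let κ : Kernel (EuclideanSpace ℝ (Fin m)) ℝ :=
    (Kernel.id ×ₖ Kernel.const _ (μ.map X)).map
      (Function.uncurry fun ξ x : EuclideanSpace ℝ (Fin m) => (inner ℝ ξ x : ℝ))
  have hκ : ∀ ξ, κ ξ = (μ.map X).map fun x => inner ℝ ξ x := fun ξ => by
    simp only [κ]
    rw [Kernel.map_apply _ hin, Kernel.prod_apply, Kernel.id_apply, Kernel.const_apply,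
      Measure.dirac_prod, Measure.map_map hin (by fun_prop)]
    rfl
  have hY : Measurable fun ω => (inner ℝ (Ξ ω) (X ω) : ℝ) := by fun_prop
  have key : condDistrib (fun ω => (inner ℝ (Ξ ω) (X ω) : ℝ)) Ξ μ =ᵐ[μ.map Ξ] κ := by
    have : IsFiniteKernel κ := by
      have : IsMarkovKernel κ := Kernel.IsMarkovKernel.map _ hin
      infer_instance
    refine condDistrib_ae_eq_of_measure_eq_compProd Ξ hY.aemeasurable ?_
    have hprod := (indepFun_iff_map_prod_eq_prod_map_map hΞ.aemeasurable hX.aemeasurable).1 h.symm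
    have hg : Measurable fun p : EuclideanSpace ℝ (Fin m) × EuclideanSpace ℝ (Fin m) =>
        (p.1, (inner ℝ p.1 p.2 : ℝ)) := by fun_prop
    have hmap : μ.map (fun ω => (Ξ ω, (inner ℝ (Ξ ω) (X ω) : ℝ)))
        = ((μ.map Ξ).prod (μ.map X)).map fun p => (p.1, (inner ℝ p.1 p.2 : ℝ)) := by
      rw [← hprod, Measure.map_map hg (hΞ.prodMk hX)]
      rfl
    rw [hmap]
    ext s hs
    rw [Measure.map_apply hg hs, Measure.prod_apply (hg hs), Measure.compProd_apply hs]
    refine lintegral_congr fun ξ => ?_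
    rw [hκ, Measure.map_apply (by fun_prop) (measurable_prodMk_left hs)]
    rfl
  filter_upwards [key] with ξ hξ
  rw [hξ, hκ]

theorem integral_condDistFun_pow (hX : Measurable X) (hΞ : Measurable Ξ) (h : IndepFun X Ξ μ)
    (j : ℕ) (y : ℝ) :
    ∫ ω, condDistFun μ (fun ω' => inner ℝ (Ξ ω') (X ω')) Ξ (Ξ ω) y ^ j ∂μ
      = (mixedProductLaw (μ.map Ξ) (μ.map X) (fun ξ x => inner ℝ ξ x) j).real
          {x | ∀ i, x i ≤ y} := by
  have : IsProbabilityMeasure (μ.map X) := Measure.isProbabilityMeasure_map hX.aemeasurable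
  have : IsProbabilityMeasure (μ.map Ξ) := Measure.isProbabilityMeasure_map hΞ.aemeasurable
  have hin := measurable_uncurry_inner (m := m)
  have hmν : Measurable fun ξ => (μ.map X).real {x | (inner ℝ ξ x : ℝ) ≤ y} :=
    (measurable_measure_prodMk_left (measurableSet_le hin measurable_const)).ennreal_toReal
  rw [mixedProductLaw_real_orthant hin, integral_map hΞ.aemeasurable
    (hmν.pow_const j).aestronglyMeasurable]
  refine integral_congr_ae ?_
  filter_upwards [ae_of_ae_map hΞ.aemeasurable (condDistrib_inner_of_indepFun hX hΞ h)] with ω hω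
  simp only [condDistFun]
  rw [cdf_eq_real, hω, map_measureReal_apply (by fun_prop) measurableSet_Iic]
  rfl

theorem charFun_mixedProductLaw_inner (hX : Measurable X) (hΞ : Measurable Ξ) {ψ : ℝ → ℝ}
    (hψ : ∀ u : EuclideanSpace ℝ (Fin m), charFun (μ.map Ξ) u = ((ψ (‖u‖ ^ 2) : ℝ) : ℂ))
    (j : ℕ) (u : EuclideanSpace ℝ (Fin j)) :
    charFun (mixedProductLaw (μ.map Ξ) (μ.map X) (fun ξ x => inner ℝ ξ x) j) u
      = ((∫ ω : Fin j → Ω, ψ (‖∑ i, u i • X (ω i)‖ ^ 2) ∂(Measure.pi fun _ => μ) : ℝ) : ℂ) := by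
  have : IsProbabilityMeasure (μ.map X) := Measure.isProbabilityMeasure_map hX.aemeasurable
  have : IsProbabilityMeasure (μ.map Ξ) := Measure.isProbabilityMeasure_map hΞ.aemeasurable
  have hin := measurable_uncurry_inner (m := m)
  have hxs : ∀ x : Fin j → EuclideanSpace ℝ (Fin m),
      ∫ ξ, Complex.exp (((∑ i, u i * inner ℝ ξ (x i) : ℝ) : ℂ) * Complex.I) ∂(μ.map Ξ)
        = charFun (μ.map Ξ) (∑ i, u i • x i) := fun x => by
    rw [charFun_apply]
    simp only [inner_sum, inner_smul_right]
  have hcf : Measurable (charFun (μ.map Ξ)) := by fun_prop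
  have hsum : Measurable fun x : Fin j → EuclideanSpace ℝ (Fin m) =>
      charFun (μ.map Ξ) (∑ i, u i • x i) := hcf.comp (by fun_prop)
  have hpi : (Measure.pi fun _ : Fin j => μ.map X)
      = (Measure.pi fun _ : Fin j => μ).map fun ω i => X (ω i) :=
    (Measure.pi_map_pi fun _ => hX.aemeasurable).symm
  -- Integrating over `ξ` first turns the inner integral into the characteristic function of `Ξ` at
  -- `∑ uᵢ xᵢ`.
  rw [charFun_mixedProductLaw hin, integral_prod_symm _ (integrable_cexp_sum_mixed hin u)]
  simp only [hxs]
  rw [hpi, integral_map (Measurable.aemeasurable (by fun_prop))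
    hsum.aestronglyMeasurable, ← integral_complex_ofReal]
  simp only [hψ]

end Conditional

/-! ### Concentration of norms of linear combinations -/

section Convergence

variable {Ω : Type*} [MeasurableSpace Ω] {μ : Measure Ω} [IsProbabilityMeasure μ] {d : ℕ → ℕ}
  {X : (n : ℕ) → Ω → EuclideanSpace ℝ (Fin (d n))} {σ : ℝ}

/-- Linear combinations of asymptotically orthogonal copies have asymptotically constant norm. -/
theorem tendstoInMeasure_norm_sum_sq (hX : ∀ n, Measurable (X n))
    (hC1 : TendstoInMeasure μ (fun n ω => ‖X n ω‖ ^ 2) atTop (fun _ => σ ^ 2))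
    (hC2 : TendstoInMeasure (μ.prod μ)
      (fun n (ω : Ω × Ω) => inner ℝ (X n ω.1) (X n ω.2)) atTop (fun _ => 0))
    {j : ℕ} (u : EuclideanSpace ℝ (Fin j)) :
    TendstoInMeasure (Measure.pi fun _ : Fin j => μ)
      (fun n ω => ‖∑ i, u i • X n (ω i)‖ ^ 2) atTop (fun _ => σ ^ 2 * ‖u‖ ^ 2) := by
  have hpair : ∀ i l : Fin j, TendstoInMeasure (Measure.pi fun _ : Fin j => μ)
      (fun n ω => (inner ℝ (X n (ω i)) (X n (ω l)) : ℝ)) atTop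
        (fun _ => if i = l then σ ^ 2 else 0) := by
    intro i l
    split_ifs with hil
    · subst hil
      simp only [real_inner_self_eq_norm_sq]
      exact tendstoInMeasure_comp_measurePreserving (e := fun ω : Fin j → Ω => ω i)
        (f := fun n ω => ‖X n ω‖ ^ 2) (measurePreserving_eval (fun _ => μ) i)
        (fun n => (hX n).norm.pow_const 2) hC1
    · refine tendstoInMeasure_comp_measurePreserving (e := fun ω : Fin j → Ω => (ω i, ω l))
        (f := fun n (ω : Ω × Ω) => (inner ℝ (X n ω.1) (X n ω.2) : ℝ))
        ⟨by fun_prop, ?_⟩ (fun n => ((hX n).comp measurable_fst).inner ((hX n).comp measurable_snd)) hC2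
      rw [← Measure.infinitePi_eq_pi]
      exact Measure.infinitePi_map_eval_prod hil
  -- The squared norm is expanded bilinearly: diagonal terms are governed by (C.1), off-diagonal
  -- ones by (C.2).
  have hsum := tendstoInMeasure_sum_const Finset.univ fun i _ =>
    tendstoInMeasure_const_mul (u i) (tendstoInMeasure_sum_const Finset.univ fun l _ =>
      tendstoInMeasure_const_mul (u l) (hpair i l))
  have hlim : ∑ i, u i * ∑ l, u l * (if i = l then σ ^ 2 else 0) = σ ^ 2 * ‖u‖ ^ 2 := by
    simp only [mul_ite, mul_zero, Finset.sum_ite_eq, Finset.mem_univ, if_true,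
      EuclideanSpace.real_norm_sq_eq, Finset.mul_sum]
    refine Finset.sum_congr rfl fun i _ => ?_
    ring
  rw [hlim] at hsum
  convert! hsum using 3 with n ω
  rw [← real_inner_self_eq_norm_sq, sum_inner]
  refine Finset.sum_congr rfl fun i _ => ?_
  rw [inner_sum, Finset.mul_sum]
  refine Finset.sum_congr rfl fun l _ => ?_
  rw [real_inner_smul_left, real_inner_smul_right]

end Convergence

/-! ### The main theorem -/

theorem ae_pos_of_lintegral_inv_pow_lt_top {G : Measure ℝ} {k : ℕ} (hk : k ≠ 0)
    (h : ∫⁻ v, (ENNReal.ofReal v)⁻¹ ^ k ∂G < ∞) : ∀ᵐ v ∂G, 0 < v := by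
  filter_upwards [ae_lt_top (by fun_prop) h.ne] with v hv
  by_contra! hcon
  rw [ENNReal.ofReal_of_nonpos hcon, ENNReal.inv_zero, ENNReal.top_pow hk] at hv
  exact lt_irrefl _ hv

theorem mainTheorem5 {Ω : Type*} [MeasurableSpace Ω] (μ : Measure Ω) [IsProbabilityMeasure μ]
    (d : ℕ → ℕ) (hd_pos : ∀ n, 0 < d n) (hd_mono : Monotone d) (hd : Tendsto d atTop atTop)
    (k : ℕ) (σ : ℝ) (hσ : 0 < σ)
    (X Ξ : (n : ℕ) → Ω → EuclideanSpace ℝ (Fin (d n)))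
    (hX : ∀ n, Measurable (X n)) (hΞ : ∀ n, Measurable (Ξ n))
    -- the random vectors `X n` are continuous
    (hX_cont : ∀ n, μ.map (X n) ≪ volume)
    -- `‖X n‖² → σ²` in probability
    (hC1 : TendstoInMeasure μ (fun n ω => ‖X n ω‖ ^ 2) atTop (fun _ => σ ^ 2))
    -- the inner product of `X n` with an independent copy tends to `0` in probability
    (hC2 : TendstoInMeasure (μ.prod μ)
      (fun n (ω : Ω × Ω) => inner ℝ (X n ω.1) (X n ω.2)) atTop (fun _ => 0))
    (hC3 : ∃ n₀, expInvSqrtDetGram μ (X n₀) k < ∞)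
    -- for almost every direction `θ`, the characteristic function of `X n` is integrable along `θ`
    (hcf : ∀ n, ∀ᵐ θ : Metric.sphere (0 : EuclideanSpace ℝ (Fin (d n))) 1
        ∂(volume : Measure (EuclideanSpace ℝ (Fin (d n)))).toSphere,
      Integrable (fun t : ℝ => charFun (μ.map (X n)) (t • (θ : EuclideanSpace ℝ (Fin (d n))))))
    -- `Ξ n` is independent of `X n` and spherically symmetric, with one `ψ` for all `n`
    (hindep : ∀ n, IndepFun (X n) (Ξ n) μ)
    (ψ : ℝ → ℝ)
    (hψ : ∀ n, ∀ u : EuclideanSpace ℝ (Fin (d n)),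
      charFun (μ.map (Ξ n)) u = ((ψ (‖u‖ ^ 2) : ℝ) : ℂ)) :
    (∃ G : Measure ℝ, IsGaussianMixing ψ G) ∧
    ∀ G : Measure ℝ, IsGaussianMixing ψ G →
      ∫⁻ v, (ENNReal.ofReal v)⁻¹ ^ k ∂G < ∞ →
      ∀ j : ℕ, 1 ≤ j → j ≤ k →
        Tendsto (fun n => ⨆ y : ℝ,
          |(∫ ω, condDistFun μ (fun ω' => inner ℝ (Ξ n ω') (X n ω')) (Ξ n) (Ξ n ω) y ^ j ∂μ)
            - ∫ v, normalDistFun (σ ^ 2 * v ^ 2) y ^ j ∂G|) atTop (𝓝 0) := by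
  have hpX : ∀ n, IsProbabilityMeasure (μ.map (X n)) := fun n =>
    Measure.isProbabilityMeasure_map (hX n).aemeasurable
  have hpΞ : ∀ n, IsProbabilityMeasure (μ.map (Ξ n)) := fun n =>
    Measure.isProbabilityMeasure_map (hΞ n).aemeasurable
  refine ⟨exists_isGaussianMixing hd_pos hd (fun n => μ.map (Ξ n)) hψ, fun G hG hGk j hj hjk => ?_⟩
  have := hG.isProbabilityMeasure
  have hG0 : ∀ᵐ v ∂G, v ≠ 0 :=
    (ae_pos_of_lintegral_inv_pow_lt_top (by omega) hGk).mono fun v hv => hv.ne'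
  have : Nonempty (Fin (d 0)) := ⟨⟨0, hd_pos 0⟩⟩
  obtain ⟨hc, hb, -⟩ := continuous_and_abs_le_one_of_charFun_eq (hψ 0)
  have hf : Measurable (Function.uncurry fun v z : ℝ => σ * v * z) := by
    simp only [Function.uncurry_def]; fun_prop
  let τ : ℕ → ProbabilityMeasure (EuclideanSpace ℝ (Fin j)) := fun n =>
    ⟨mixedProductLaw (μ.map (Ξ n)) (μ.map (X n)) (fun ξ x => inner ℝ ξ x) j,
      isProbabilityMeasure_mixedProductLaw measurable_uncurry_inner⟩
  let τ₀ : ProbabilityMeasure (EuclideanSpace ℝ (Fin j)) :=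
    ⟨mixedProductLaw G (gaussianReal 0 1) (fun v z => σ * v * z) j,
      isProbabilityMeasure_mixedProductLaw hf⟩
  have hτ : Tendsto τ atTop (𝓝 τ₀) := by
    refine ProbabilityMeasure.tendsto_of_tendsto_charFun fun u => ?_
    simp only [τ, τ₀, ProbabilityMeasure.coe_mk]
    rw [charFun_gaussianMixture hG]
    simp only [fun n => charFun_mixedProductLaw_inner (hX n) (hΞ n) (hψ n) j u]
    refine (Complex.continuous_ofReal.tendsto _).comp ?_
    have hlim := tendsto_integral_comp_of_tendstoInMeasure (fun n => by fun_prop)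
      (tendstoInMeasure_norm_sum_sq hX hC1 hC2 u) hc hb
    have hnn : 0 ≤ σ ^ 2 * ‖u‖ ^ 2 := by positivity
    simpa only [max_eq_left hnn, max_eq_left (sq_nonneg _)] using hlim
  refine tendsto_iSup_abs_sub_of_monotone (fun n => ?_) (fun n y => ?_) (fun n y => ?_)
    monotone_integral_normalDistFun_pow (continuous_integral_normalDistFun_pow hσ.ne' hG0)
    (tendsto_integral_normalDistFun_pow_atBot (by omega)) tendsto_integral_normalDistFun_pow_atTop
    (fun y => ?_)
  · intro y y' hy
    have := isProbabilityMeasure_mixedProductLaw (ρ := μ.map (Ξ n)) (ν := μ.map (X n)) (j := j)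
      (measurable_uncurry_inner (m := d n))
    -- As orthant probabilities, the moments are monotone in `y` by inclusion of sets.
    simp only [integral_condDistFun_pow (hX n) (hΞ n) (hindep n)]
    exact measureReal_mono fun x hx i => (hx i).trans hy
  · exact integral_nonneg fun ω => pow_nonneg (cdf_nonneg _ _) _
  · have := isProbabilityMeasure_mixedProductLaw (ρ := μ.map (Ξ n)) (ν := μ.map (X n)) (j := j)
      (measurable_uncurry_inner (m := d n))
    rw [integral_condDistFun_pow (hX n) (hΞ n) (hindep n)]
    exact measureReal_le_one
  · simp only [fun n => integral_condDistFun_pow (hX n) (hΞ n) (hindep n) j y]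
    rw [← gaussianMixture_real_orthant]
    -- The orthant is a continuity set of the limit law, so the portmanteau theorem applies.
    have h0 : (τ₀ : Measure (EuclideanSpace ℝ (Fin j))) (frontier {x | ∀ i, x i ≤ y}) = 0 :=
      measure_mono_null (frontier_orthant_subset y)
        (measure_iUnion_null fun i => gaussianMixture_coord_eq hσ.ne' hG0 i y)
    exact (ENNReal.tendsto_toReal (measure_ne_top (τ₀ : Measure (EuclideanSpace ℝ (Fin j))) _)).comp
      (ProbabilityMeasure.tendsto_measure_of_null_frontier_of_tendsto' hτ h0)
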